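/- Let \textbf{\textsf{Q}} (Robinson Arithmetic) be the first-order theory with equality in the language $0, S, +, \times$ given by the axioms \begin{align*} &\forall x\; \neg\, Sx = 0, && \forall x, y\; (Sx = Sy \rightarrow x = y), && \forall x\; (x = 0 \lor \exists y\; Sy = x),\\ &\forall x\; x + 0 = x, && \forall x,y\; x + Sy = S(x+y), &&\\ &\forall x\; x \times 0 = 0, && \forall x,y\; x \times Sy = x + (x \times y). && \end{align*} For $n \in \mathbb{N}$ let $\overline{n}$ be the numeral $S\cdots S0$ with $n$ occurrences of $S$. Write $\textbf{\textsf{Q}} \vdash A$ if the sentence $A$ is derivable from these axioms by natural deduction in classical first-order logic with equality, and let $\exists!\, y\; P(y)$ abbreviate $\exists y\,(P(y) \land \forall z\,(P(z) \rightarrow z = y))$. Then $\textbf{\textsf{Q}}$ represents every computable function: for every $k \in \mathbb{N}$ and every computable (that is, partial recursive) partial function $f \colon \mathbb{N}^k \to \mathbb{N}$ there is a formula $\varphi(x_1,\dots,x_k,y)$ in the language of arithmetic, with free variables among $x_1,\dots,x_k,y$, such that for all $x_1,\dots,x_k,y \in \mathbb{N}$, whenever $f(x_1,\dots,x_k)$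 is defined and equal to $y$, \[ \textbf{\textsf{Q}} \vdash \bigl(\exists!\, y\; \varphi(\overline{x_1},\dots,\overline{x_k},y)\bigr) \land \varphi(\overline{x_1},\dots,\overline{x_k},\overline{y}). \] -/

import Mathlib

open FirstOrder

namespace Arith

/-- The function symbols of the language of arithmetic: `0`, `S`, `+`, `×`. -/
inductive Func : ℕ → Type
  | zero : Func 0
  | succ : Func 1
  | add : Func 2
  | mul : Func 2

/-- The first-order language of arithmetic (equality is a logical symbol). -/
def lang : Language :=
  { Functions := Func
    Relations := fun _ => Empty }

/-- Terms whose variables are among `&0, …, &(n-1)`. -/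
abbrev Tm (n : ℕ) : Type := lang.Term (Empty ⊕ Fin n)

/-- Formulas whose free variables are among `&0, …, &(n-1)`; in `∀' φ` with `φ : Fml (n + 1)`,
the bound variable is `&n`. -/
abbrev Fml (n : ℕ) : Type := lang.BoundedFormula Empty n

namespace Tm

/-- The `i`-th variable. -/
def v {n : ℕ} (i : Fin n) : Tm n := Language.Term.var (Sum.inr i)

def zero {n : ℕ} : Tm n := Language.Constants.term (L := lang) Func.zero

def succ {n : ℕ} (t : Tm n) : Tm n := Language.Functions.apply₁ (L := lang) Func.succ t

def add {n : ℕ} (t s : Tm n) : Tm n := Language.Functions.apply₂ (L := lang) Func.add t s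

def mul {n : ℕ} (t s : Tm n) : Tm n := Language.Functions.apply₂ (L := lang) Func.mul t s

/-- The numeral `S…S0` with `x` occurrences of `S`. -/
def num {n : ℕ} : ℕ → Tm n
  | 0 => zero
  | x + 1 => succ (num x)

/-- Simultaneous substitution of `σ i` for the variable `&i`. -/
def sub {n m : ℕ} (σ : Fin n → Tm m) (t : Tm n) : Tm m :=
  Language.Term.subst t (Sum.elim Empty.elim σ)

/-- Weakening: the same term, regarded as a term in one more variable `&n`. -/
def weaken {n : ℕ} (t : Tm n) : Tm (n + 1) := t.sub fun i => v i.castSucc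

end Tm

namespace Fml

/-- Simultaneous capture-free substitution of `σ i` for the free variable `&i`. -/
def sub : {n m : ℕ} → (Fin n → Tm m) → Fml n → Fml m
  | _, _, _, .falsum => .falsum
  | _, _, σ, .equal t s => .equal (Tm.sub σ t) (Tm.sub σ s)
  | _, _, σ, .rel R ts => .rel R fun i => Tm.sub σ (ts i)
  | _, _, σ, .imp φ ψ => .imp (sub σ φ) (sub σ ψ)
  | _, m, σ, .all φ => .all (sub (Fin.snoc (fun i => (σ i).weaken) (Tm.v (Fin.last m))) φ)

/-- The same formula, regarded as a formula in one more variable `&n`. -/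
def weaken {n : ℕ} (φ : Fml n) : Fml (n + 1) := φ.sub fun i => Tm.v i.castSucc

/-- `φ[t]`: substitution of `t` for the last free variable `&n`. -/
def inst {n : ℕ} (φ : Fml (n + 1)) (t : Tm n) : Fml n :=
  φ.sub (Fin.snoc (fun i => Tm.v i) t)

/-- `∃! x, φ(x)`, that is `∃ x, φ(x) ∧ ∀ y, φ(y) → y = x`. -/
def existsUnique {n : ℕ} (φ : Fml (n + 1)) : Fml n :=
  ∃' (φ ⊓ ∀' (φ.sub (Fin.snoc (fun i => Tm.v i.castSucc.castSucc) (Tm.v (Fin.last (n + 1)))) ⟹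
    (Tm.v (Fin.last (n + 1)) =' Tm.v (Fin.last n).castSucc)))

end Fml

/-- Natural deduction for classical first-order logic with equality. `Derivable Γ φ` says that `φ`
is derivable from the hypotheses `Γ`, where the free variables of `Γ` and `φ` are among
`&0, …, &(n-1)`. The connectives other than `⊥`, `→`, `∀` and `=` are abbreviations:
`¬ φ` is `φ → ⊥`, `φ ∨ ψ` is `¬ φ → ψ`, `φ ∧ ψ` is `¬ (φ → ¬ ψ)` and `∃ x, φ` is `¬ ∀ x, ¬ φ`. -/
inductive Derivable : {n : ℕ} → Set (Fml n) → Fml n → Prop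
  | hyp {n : ℕ} {Γ : Set (Fml n)} {φ : Fml n} : φ ∈ Γ → Derivable Γ φ
  | impIntro {n : ℕ} {Γ : Set (Fml n)} {φ ψ : Fml n} :
      Derivable (insert φ Γ) ψ → Derivable Γ (φ ⟹ ψ)
  | impElim {n : ℕ} {Γ : Set (Fml n)} {φ ψ : Fml n} :
      Derivable Γ (φ ⟹ ψ) → Derivable Γ φ → Derivable Γ ψ
  | byContradiction {n : ℕ} {Γ : Set (Fml n)} {φ : Fml n} :
      Derivable (insert (∼φ) Γ) ⊥ → Derivable Γ φ
  | allIntro {n : ℕ} {Γ : Set (Fml n)} {φ : Fml (n + 1)} :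
      Derivable (Fml.weaken '' Γ) φ → Derivable Γ (∀' φ)
  | allElim {n : ℕ} {Γ : Set (Fml n)} {φ : Fml (n + 1)} (t : Tm n) :
      Derivable Γ (∀' φ) → Derivable Γ (φ.inst t)
  | eqRefl {n : ℕ} {Γ : Set (Fml n)} (t : Tm n) : Derivable Γ (t =' t)
  | eqSubst {n : ℕ} {Γ : Set (Fml n)} (φ : Fml (n + 1)) {t s : Tm n} :
      Derivable Γ (t =' s) → Derivable Γ (φ.inst t) → Derivable Γ (φ.inst s)

/-- `T` proves the sentence `A`, where `T` is given by a set of axioms. -/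
def Proves (T : lang.Theory) (A : lang.Sentence) : Prop := Derivable (n := 0) T A

open Tm in
/-- The axioms of Robinson Arithmetic. -/
inductive QAxiom : lang.Sentence → Prop
  /-- `∀ x, ¬ S x = 0` -/
  | S0 : QAxiom (∀' ∼(succ (v 0) =' zero))
  /-- `∀ x y, S x = S y → x = y` -/
  | S1 : QAxiom (∀' ∀' ((succ (v 0) =' succ (v 1)) ⟹ (v 0 =' v 1)))
  /-- `∀ x, x = 0 ∨ ∃ y, S y = x` -/
  | S2 : QAxiom (∀' ((v 0 =' zero) ⊔ ∃' (succ (v 1) =' v 0)))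
  /-- `∀ x, x + 0 = x` -/
  | A0 : QAxiom (∀' (add (v 0) zero =' v 0))
  /-- `∀ x y, x + S y = S (x + y)` -/
  | A1 : QAxiom (∀' ∀' (add (v 0) (succ (v 1)) =' succ (add (v 0) (v 1))))
  /-- `∀ x, x × 0 = 0` -/
  | M0 : QAxiom (∀' (mul (v 0) zero =' zero))
  /-- `∀ x y, x × S y = x + (x × y)` -/
  | M1 : QAxiom (∀' ∀' (mul (v 0) (succ (v 1)) =' add (v 0) (mul (v 0) (v 1))))

/-- Robinson Arithmetic. -/
def Q : lang.Theory := {A | QAxiom A}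

/-- `φ(x̄₁, …, x̄ₖ, t)`: numerals for the first `k` variables of `φ`, the term `t` for the last. -/
def Fml.app {k n : ℕ} (φ : Fml (k + 1)) (x : List.Vector ℕ k) (t : Tm n) : Fml n :=
  φ.sub (Fin.snoc (fun i => Tm.num (x.get i)) t)

/-- The formula `φ` represents the partial function `f` in `T`: whenever `f(x) = y`, the theory `T`
proves `(∃! y, φ(x̄, y)) ∧ φ(x̄, ȳ)`. -/
def Represents (T : lang.Theory) {k : ℕ} (φ : Fml (k + 1)) (f : List.Vector ℕ k →. ℕ) : Prop :=
  ∀ (x : List.Vector ℕ k) (y : ℕ), y ∈ f x →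
    Proves T (Fml.existsUnique (φ.app x (Tm.v (Fin.last 0))) ⊓ φ.app x (Tm.num y))

/-- The partial function `f : ℕᵏ → ℕ` is represented in `T` by some formula. -/
def Representable (T : lang.Theory) {k : ℕ} (f : List.Vector ℕ k →. ℕ) : Prop :=
  ∃ φ : Fml (k + 1), Represents T φ f

end Arith

/-! The argument is semantic. By Gödel's completeness theorem (`proves_of_forall_model`) it suffices
to find a formula that, in every model of Q and for all numeral arguments in the domain of `f`, is
satisfied by the value's numeral and by no other element, standard or not (`Defines`). Both
conjuncts of the required sentence then follow at once (`representable_of_isRep`).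

Such formulas exist for all partial recursive functions by induction on their generation.
Projections, addition and multiplication are given by terms; composition is an existential
quantification over intermediate values. Minimization works because Q proves enough about order
relative to a numeral: an element below a numeral is a numeral, and every element is comparable with
every numeral (`IsQModel.lt_num_iff`, `IsQModel.trichotomy`). Primitive recursion reduces to
minimization: Gödel's beta function codes the finite sequence of values, and the least code is
searched for.

Completeness is proved by a Henkin construction in which the variables themselves are the witnesses.
Complete sets `Γ n` of formulas in `n` variables are built successively, the new variable `&n`
serving as witness for one universal formula. The model consists of terms in countably many
variables, two terms being identified when all large enough stages prove them equal. -/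

namespace Arith

/-! ### Calculus of substitutions -/

namespace Tm

theorem sub_v {n m : ℕ} (σ : Fin n → Tm m) (i : Fin n) : (v i).sub σ = σ i := rfl

theorem sub_sub {n m l : ℕ} (σ : Fin n → Tm m) (τ : Fin m → Tm l) (t : Tm n) :
    (t.sub σ).sub τ = t.sub fun i => (σ i).sub τ := by
  induction t with
  | var x => rcases x with x | x; exacts [x.elim, rfl]
  | func f ts ih =>
    simp only [sub, Language.Term.subst] at ih ⊢
    congr 1; funext i; exact ih i

theorem sub_id {n : ℕ} (t : Tm n) : t.sub v = t := by
  induction t with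
  | var x => rcases x with x | x; exacts [x.elim, rfl]
  | func f ts ih =>
    simp only [sub, Language.Term.subst] at ih ⊢
    congr 1; funext i; exact ih i

end Tm

namespace Fml

open Tm

/-- The substitution under a quantifier that is induced by `σ`. -/
def up {n m : ℕ} (σ : Fin n → Tm m) : Fin (n + 1) → Tm (m + 1) :=
  Fin.snoc (fun i => (σ i).weaken) (Tm.v (Fin.last m))

theorem up_comp {n m l : ℕ} (σ : Fin n → Tm m) (τ : Fin m → Tm l) :
    (fun i => (up σ i).sub (up τ)) = up fun i => (σ i).sub τ := by
  funext i
  refine Fin.lastCases ?_ (fun i => ?_) i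
  · simp [up, sub_v]
  · simp [up, Tm.weaken, Tm.sub_sub, sub_v]

theorem up_v {n : ℕ} : up (fun i : Fin n => v i) = v := by
  funext i
  refine Fin.lastCases ?_ (fun i => ?_) i
  · simp [up]
  · simp [up, Tm.weaken, sub_v]

theorem sub_sub {n m l : ℕ} (σ : Fin n → Tm m) (τ : Fin m → Tm l) (φ : Fml n) :
    (φ.sub σ).sub τ = φ.sub fun i => (σ i).sub τ := by
  induction φ generalizing m l with
  | falsum => rfl
  | equal t s => simp only [sub, Tm.sub_sub]
  | rel R ts => exact R.elim
  | imp φ ψ ih₁ ih₂ => simp only [sub, ih₁, ih₂]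
  | all φ ih =>
    simp only [sub]
    exact congrArg _ ((ih _ _).trans (congrArg (fun σ => sub σ φ) (up_comp σ τ)))

theorem sub_id {n : ℕ} (φ : Fml n) : (φ.sub fun i => v i) = φ := by
  induction φ with
  | falsum => rfl
  | equal t s => simp only [sub]; rw [Tm.sub_id, Tm.sub_id]
  | rel R ts => exact R.elim
  | imp φ ψ ih₁ ih₂ => simp only [sub, ih₁, ih₂]
  | all φ ih =>
    simp only [sub]
    exact congrArg _ ((congrArg (fun σ => sub σ φ) up_v).trans ih)

theorem inst_weaken {n : ℕ} (φ : Fml n) (t : Tm n) : φ.weaken.inst t = φ := by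
  rw [weaken, inst, sub_sub]
  simpa [sub_v] using sub_id φ

theorem weaken_sub {n m : ℕ} (φ : Fml n) (σ : Fin n → Tm m) :
    (φ.sub σ).weaken = φ.sub fun i => (σ i).weaken := sub_sub _ _ _

/-- Turns an instance of a substituted universal formula into a single simultaneous substitution,
the form in which the truth lemma handles quantifiers. -/
theorem inst_sub_up {n m : ℕ} (φ : Fml (n + 1)) (σ : Fin n → Tm m) (t : Tm m) :
    (φ.sub (up σ)).inst t = φ.sub (Fin.snoc σ t : Fin (n + 1) → Tm m) := by
  rw [inst, sub_sub]
  congr 1; funext i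
  refine Fin.lastCases ?_ (fun i => ?_) i
  · simp [up, sub_v]
  · simp only [up, Fin.snoc_castSucc, Tm.weaken, Tm.sub_sub, sub_v]
    exact Tm.sub_id _

end Fml

/-! ### Monotonicity and finiteness of derivations -/

namespace Derivable

theorem mono {n : ℕ} {Γ Δ : Set (Fml n)} {φ : Fml n} (h : Derivable Γ φ) (hΓ : Γ ⊆ Δ) :
    Derivable Δ φ := by
  induction h with
  | hyp h => exact .hyp (hΓ h)
  | impIntro _ ih => exact .impIntro (ih (Set.insert_subset_insert hΓ))
  | impElim _ _ ih₁ ih₂ => exact .impElim (ih₁ hΓ) (ih₂ hΓ)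
  | byContradiction _ ih => exact .byContradiction (ih (Set.insert_subset_insert hΓ))
  | allIntro _ ih => exact .allIntro (ih (Set.image_mono hΓ))
  | allElim t _ ih => exact .allElim t (ih hΓ)
  | eqRefl t => exact .eqRefl t
  | eqSubst φ _ _ ih₁ ih₂ => exact .eqSubst φ (ih₁ hΓ) (ih₂ hΓ)

theorem exists_finite_of_insert {n : ℕ} {Γ : Set (Fml n)} {φ ψ : Fml n}
    (h : ∃ Δ ⊆ insert φ Γ, Δ.Finite ∧ Derivable Δ ψ) :
    ∃ Δ ⊆ Γ, Δ.Finite ∧ Derivable (insert φ Δ) ψ := by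
  obtain ⟨Δ, hΔ, hfin, hd⟩ := h
  refine ⟨Δ \ {φ}, ?_, hfin.sdiff, hd.mono ?_⟩
  · rintro x ⟨hx, hne⟩
    exact (hΔ hx).resolve_left hne
  · intro x hx
    by_cases h : x = φ
    · exact Or.inl h
    · exact Or.inr ⟨hx, h⟩

/-- A derivation uses only finitely many hypotheses. -/
theorem exists_finite {n : ℕ} {Γ : Set (Fml n)} {φ : Fml n} (h : Derivable Γ φ) :
    ∃ Δ ⊆ Γ, Δ.Finite ∧ Derivable Δ φ := by
  induction h with
  | @hyp n Γ φ h => exact ⟨{φ}, by simpa using h, Set.finite_singleton _, .hyp rfl⟩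
  | impIntro _ ih =>
    obtain ⟨Δ, h₁, h₂, h₃⟩ := exists_finite_of_insert ih
    exact ⟨Δ, h₁, h₂, .impIntro h₃⟩
  | impElim _ _ ih₁ ih₂ =>
    obtain ⟨Δ, h₁, h₂, h₃⟩ := ih₁
    obtain ⟨Δ', h₁', h₂', h₃'⟩ := ih₂
    exact ⟨Δ ∪ Δ', Set.union_subset h₁ h₁', h₂.union h₂',
      .impElim (h₃.mono Set.subset_union_left) (h₃'.mono Set.subset_union_right)⟩
  | byContradiction _ ih =>
    obtain ⟨Δ, h₁, h₂, h₃⟩ := exists_finite_of_insert ih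
    exact ⟨Δ, h₁, h₂, .byContradiction h₃⟩
  | allIntro _ ih =>
    obtain ⟨Δ, h₁, h₂, h₃⟩ := Set.exists_subset_image_finite_and.1 ih
    exact ⟨Δ, h₁, h₂, .allIntro h₃⟩
  | allElim t _ ih =>
    obtain ⟨Δ, h₁, h₂, h₃⟩ := ih
    exact ⟨Δ, h₁, h₂, .allElim t h₃⟩
  | eqRefl t => exact ⟨∅, Set.empty_subset _, Set.finite_empty, .eqRefl t⟩
  | eqSubst φ _ _ ih₁ ih₂ =>
    obtain ⟨Δ, h₁, h₂, h₃⟩ := ih₁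
    obtain ⟨Δ', h₁', h₂', h₃'⟩ := ih₂
    exact ⟨Δ ∪ Δ', Set.union_subset h₁ h₁', h₂.union h₂',
      .eqSubst φ (h₃.mono Set.subset_union_left) (h₃'.mono Set.subset_union_right)⟩

theorem of_bot {n : ℕ} {Γ : Set (Fml n)} {φ : Fml n} (h : Derivable Γ ⊥) : Derivable Γ φ :=
  .byContradiction (h.mono (Set.subset_insert _ _))

end Derivable

/-! ### Complete sets and Henkin witnesses -/

/-- `Γ` does not derive `⊥`. -/
def Consistent {n : ℕ} (Γ : Set (Fml n)) : Prop := ¬ Derivable Γ ⊥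

/-- `Γ` is consistent and decides every formula. -/
structure IsComplete {n : ℕ} (Γ : Set (Fml n)) : Prop where
  consistent : Consistent Γ
  mem_or_not_mem : ∀ φ, φ ∈ Γ ∨ ∼φ ∈ Γ

namespace IsComplete

variable {n : ℕ} {Γ : Set (Fml n)}

theorem mem_of_derivable (hΓ : IsComplete Γ) {φ : Fml n} (h : Derivable Γ φ) : φ ∈ Γ :=
  (hΓ.mem_or_not_mem φ).resolve_right fun h' => hΓ.consistent (.impElim (.hyp h') h)

theorem mem_imp (hΓ : IsComplete Γ) {φ ψ : Fml n} : (φ ⟹ ψ) ∈ Γ ↔ (φ ∈ Γ → ψ ∈ Γ) := by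
  refine ⟨fun h h' => hΓ.mem_of_derivable (.impElim (.hyp h) (.hyp h')), fun h => ?_⟩
  rcases hΓ.mem_or_not_mem φ with h' | h'
  · exact hΓ.mem_of_derivable (.impIntro (.hyp (Or.inr (h h'))))
  · exact hΓ.mem_of_derivable
      (.impIntro (Derivable.of_bot (.impElim (.hyp (Or.inr h')) (.hyp (Or.inl rfl)))))

theorem bot_notMem (hΓ : IsComplete Γ) : (⊥ : Fml n) ∉ Γ := fun h => hΓ.consistent (.hyp h)

theorem not_mem (hΓ : IsComplete Γ) {φ : Fml n} : ∼φ ∈ Γ ↔ φ ∉ Γ :=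
  hΓ.mem_imp.trans (by simp [hΓ.bot_notMem])

theorem inst_mem (hΓ : IsComplete Γ) {φ : Fml (n + 1)} (h : (∀' φ) ∈ Γ) (t : Tm n) :
    φ.inst t ∈ Γ :=
  hΓ.mem_of_derivable (.allElim t (.hyp h))

end IsComplete

namespace Consistent

variable {n : ℕ} {Γ : Set (Fml n)}

/-- Lindenbaum's lemma. -/
theorem exists_isComplete (hΓ : Consistent Γ) : ∃ Δ, Γ ⊆ Δ ∧ IsComplete Δ := by
  obtain ⟨Δ, hΔ, hmax⟩ := zorn_subset_nonempty {Δ : Set (Fml n) | Consistent Δ} (by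
    intro c hc hchain hne
    refine ⟨⋃₀ c, fun h => ?_, fun s hs => Set.subset_sUnion_of_mem hs⟩
    obtain ⟨Δ, h₁, h₂, h₃⟩ := Derivable.exists_finite h
    -- The finitely many hypotheses used already lie in one member of the chain.
    obtain ⟨s, hs, hsub⟩ := DirectedOn.exists_mem_subset_of_finite_of_subset_sUnion
      hne hchain.directedOn h₂ h₁
    exact hc hs (h₃.mono hsub)) Γ hΓ
  refine ⟨Δ, hΔ, hmax.prop, fun φ => ?_⟩
  by_contra! h
  have key : ∀ ψ, ψ ∉ Δ → Derivable (insert ψ Δ) ⊥ := fun ψ hψ => by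
    by_contra hc
    exact hψ (hmax.le_of_ge hc (Set.subset_insert ψ Δ) (Set.mem_insert ψ Δ))
  exact hmax.prop (.impElim (.impIntro (key _ h.2)) (.impIntro (key _ h.1)))

/-- The variable `&n` may be taken as a Henkin witness for `∀' ψ`. -/
theorem insert_henkin (hΓ : Consistent Γ) (ψ : Fml (n + 1)) :
    Consistent (insert (ψ ⟹ Fml.weaken (∀' ψ)) (Fml.weaken '' Γ)) := by
  intro h
  -- Refuting the implication classically yields both its antecedent `ψ` and the negation of its
  -- consequent; generalizing each over the fresh variable gives `h₁` and `h₂`.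
  have h₁ : Derivable Γ (∀' ψ) := by
    refine .allIntro (.byContradiction (.impElim (.impIntro (h.mono ?_ : Derivable
      (insert (ψ ⟹ Fml.weaken (∀' ψ)) (insert (∼ψ) (Fml.weaken '' Γ))) ⊥)) (.impIntro ?_)))
    · exact Set.insert_subset_insert (Set.subset_insert _ _)
    · exact Derivable.of_bot (.impElim (.hyp (Or.inr (Or.inl rfl))) (.hyp (Or.inl rfl)))
  have h₂ : Derivable Γ (∀' ∼(Fml.weaken (∀' ψ))) := by
    refine .allIntro (.impIntro (.impElim (.impIntro (h.mono ?_ : Derivable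
      (insert (ψ ⟹ Fml.weaken (∀' ψ)) (insert (Fml.weaken (∀' ψ)) (Fml.weaken '' Γ))) ⊥)) (.impIntro ?_)))
    · exact Set.insert_subset_insert (Set.subset_insert _ _)
    · exact .hyp (Or.inr (Or.inl rfl))
  -- The closed term `0` discharges the vacuous quantifier even when there are no variables.
  have h₃ : Derivable Γ (Fml.inst (∼(Fml.weaken (∀' ψ))) Tm.zero) := .allElim _ h₂
  have h₄ : Derivable Γ (((Fml.weaken (∀' ψ)).inst Tm.zero) ⟹ ⊥) := h₃
  rw [Fml.inst_weaken] at h₄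
  exact hΓ (.impElim h₄ h₁)

/-- A chain of complete sets of formulas, one for each number of variables, in which the `n`-th
step has a Henkin axiom for `ψ n`. -/
theorem exists_henkin_chain {T : Set (Fml 0)} (hT : Consistent T) (ψ : ∀ n, Fml (n + 1)) :
    ∃ Γ : ∀ n, Set (Fml n), T ⊆ Γ 0 ∧ (∀ n, IsComplete (Γ n)) ∧
      (∀ n, ∀ φ ∈ Γ n, φ.weaken ∈ Γ (n + 1)) ∧
      ∀ n, (ψ n ⟹ Fml.weaken (∀' (ψ n))) ∈ Γ (n + 1) := by
  obtain ⟨Γ₀, h₀, hc₀⟩ := hT.exists_isComplete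
  have step : ∀ n (Γ : {Γ : Set (Fml n) // IsComplete Γ}),
      ∃ Δ : {Δ : Set (Fml (n + 1)) // IsComplete Δ},
        insert (ψ n ⟹ Fml.weaken (∀' (ψ n))) (Fml.weaken '' Γ.1) ⊆ Δ.1 := fun n Γ => by
    obtain ⟨Δ, h, hc⟩ := (Γ.2.consistent.insert_henkin (ψ n)).exists_isComplete
    exact ⟨⟨Δ, hc⟩, h⟩
  choose next hnext using step
  let Γ : ∀ n, {Γ : Set (Fml n) // IsComplete Γ} := fun n => Nat.rec ⟨Γ₀, hc₀⟩ next n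
  exact ⟨fun n => (Γ n).1, h₀, fun n => (Γ n).2,
    fun n φ hφ => hnext n (Γ n) (Or.inr ⟨φ, hφ, rfl⟩), fun n => hnext n (Γ n) (Or.inl rfl)⟩

end Consistent

open Filter

/-! ### Equality in complete sets -/

namespace Tm

theorem sub_snoc_weaken {n : ℕ} (u t : Tm n) :
    u.weaken.sub (Fin.snoc (fun i => v i) t : Fin (n + 1) → Tm n) = u := by
  rw [weaken, sub_sub]
  simpa [sub_v] using sub_id u

end Tm

namespace IsComplete

variable {n : ℕ} {Γ : Set (Fml n)}

theorem eq_refl_mem (hΓ : IsComplete Γ) (t : Tm n) : (t =' t) ∈ Γ :=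
  hΓ.mem_of_derivable (.eqRefl t)

theorem inst_mem_of_eq_mem (hΓ : IsComplete Γ) (φ : Fml (n + 1)) {t s : Tm n}
    (h : (t =' s) ∈ Γ) (h' : φ.inst t ∈ Γ) : φ.inst s ∈ Γ :=
  hΓ.mem_of_derivable (.eqSubst φ (.hyp h) (.hyp h'))

theorem eq_symm_mem (hΓ : IsComplete Γ) {t s : Tm n} (h : (t =' s) ∈ Γ) : (s =' t) ∈ Γ := by
  have key : ∀ u, Fml.inst (Tm.v (Fin.last n) =' t.weaken) u = (u =' t) := fun u => by
    simp [Fml.inst, Fml.sub, Language.Term.bdEqual, Tm.sub_snoc_weaken, Tm.sub_v]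
  rw [← key]
  exact hΓ.inst_mem_of_eq_mem _ h (by rw [key]; exact hΓ.eq_refl_mem t)

theorem eq_trans_mem (hΓ : IsComplete Γ) {t s r : Tm n} (h : (t =' s) ∈ Γ)
    (h' : (s =' r) ∈ Γ) : (t =' r) ∈ Γ := by
  have key : ∀ u, Fml.inst (t.weaken =' Tm.v (Fin.last n)) u = (t =' u) := fun u => by
    simp [Fml.inst, Fml.sub, Language.Term.bdEqual, Tm.sub_snoc_weaken, Tm.sub_v]
  rw [← key]
  exact hΓ.inst_mem_of_eq_mem _ h' (by rw [key]; exact h)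

/-- Leibniz's rule applied to the equation `u(t) = u(x)`, with `x` the replaced variable. -/
theorem sub_eq_mem (hΓ : IsComplete Γ) (u : Tm (n + 1)) {t s : Tm n} (h : (t =' s) ∈ Γ) :
    (u.sub (Fin.snoc (fun i => Tm.v i) t) =' u.sub (Fin.snoc (fun i => Tm.v i) s)) ∈ Γ := by
  have key : ∀ r, Fml.inst ((u.sub (Fin.snoc (fun i => Tm.v i) t)).weaken =' u) r =
      (u.sub (Fin.snoc (fun i => Tm.v i) t) =' u.sub (Fin.snoc (fun i => Tm.v i) r)) :=
    fun r => by
      simp [Fml.inst, Fml.sub, Language.Term.bdEqual, Tm.sub_snoc_weaken]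
  rw [← key]
  exact hΓ.inst_mem_of_eq_mem _ h (by rw [key]; exact hΓ.eq_refl_mem _)

theorem func_eq_mem_one (hΓ : IsComplete Γ) (f : lang.Functions 1) {t s : Fin 1 → Tm n}
    (h : ∀ i, (t i =' s i) ∈ Γ) :
    ((Language.Term.func f t : Tm n) =' Language.Term.func f s) ∈ Γ := by
  have key : ∀ r : Fin 1 → Tm n, (Language.Term.func f r : Tm n) =
      Tm.sub (Fin.snoc (fun i => Tm.v i) (r 0)) (.func f fun _ => Tm.v (Fin.last n)) :=
    fun r => by
      simp only [Tm.sub, Language.Term.subst]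
      congr 1; funext i
      simp [Tm.v, Language.Term.subst, Subsingleton.elim i 0]
  rw [key t, key s]
  exact hΓ.sub_eq_mem _ (h 0)

/-- The equality rule replaces one term at a time, so the arguments are exchanged in turn and the
results joined by transitivity. -/
theorem func_eq_mem_two (hΓ : IsComplete Γ) (f : lang.Functions 2) {t s : Fin 2 → Tm n}
    (h : ∀ i, (t i =' s i) ∈ Γ) :
    ((Language.Term.func f t : Tm n) =' Language.Term.func f s) ∈ Γ := by
  have key₁ : ∀ r : Tm n, (Language.Term.func f ![r, t 1] : Tm n) =
      Tm.sub (Fin.snoc (fun i => Tm.v i) r) (.func f ![Tm.v (Fin.last n), (t 1).weaken]) :=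
    fun r => by
      simp only [Tm.sub, Language.Term.subst]
      congr 1; funext i
      fin_cases i
      · simp [Tm.v, Language.Term.subst]
      · exact (Tm.sub_snoc_weaken _ _).symm
  have key₂ : ∀ r : Tm n, (Language.Term.func f ![s 0, r] : Tm n) =
      Tm.sub (Fin.snoc (fun i => Tm.v i) r) (.func f ![(s 0).weaken, Tm.v (Fin.last n)]) :=
    fun r => by
      simp only [Tm.sub, Language.Term.subst]
      congr 1; funext i
      fin_cases i
      · exact (Tm.sub_snoc_weaken _ _).symm
      · simp [Tm.v, Language.Term.subst]
  have h₁ : ((Language.Term.func f ![t 0, t 1] : Tm n) =' .func f ![s 0, t 1]) ∈ Γ := by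
    rw [key₁, key₁]; exact hΓ.sub_eq_mem _ (h 0)
  have h₂ : ((Language.Term.func f ![s 0, t 1] : Tm n) =' .func f ![s 0, s 1]) ∈ Γ := by
    rw [key₂, key₂]; exact hΓ.sub_eq_mem _ (h 1)
  have e : ∀ r : Fin 2 → Tm n, r = ![r 0, r 1] := fun r => by
    funext i; fin_cases i <;> rfl
  rw [e t, e s]
  exact hΓ.eq_trans_mem h₁ h₂

theorem func_eq_mem (hΓ : IsComplete Γ) {l : ℕ} (f : lang.Functions l) {t s : Fin l → Tm n}
    (h : ∀ i, (t i =' s i) ∈ Γ) :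
    ((Language.Term.func f t : Tm n) =' Language.Term.func f s) ∈ Γ := by
  cases f with
  | zero => rw [Subsingleton.elim t s]; exact hΓ.eq_refl_mem _
  | succ => exact hΓ.func_eq_mem_one _ h
  | add => exact hΓ.func_eq_mem_two _ h
  | mul => exact hΓ.func_eq_mem_two _ h

end IsComplete

/-! ### Limits of chains and the term model -/

/-- The term `t` in the variables `&0, …, &(k-1)`; other variables are replaced by `0`. -/
def restrict (k : ℕ) (t : lang.Term ℕ) : Tm k :=
  t.subst fun i => if h : i < k then Tm.v ⟨i, h⟩ else Tm.zero

/-- Substitution of terms with variables in `ℕ`. -/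
def substNat {n : ℕ} (ρ : Fin n → lang.Term ℕ) (t : Tm n) : lang.Term ℕ :=
  t.subst (Sum.elim Empty.elim ρ)

theorem restrict_substNat {n : ℕ} (k : ℕ) (ρ : Fin n → lang.Term ℕ) (t : Tm n) :
    restrict k (substNat ρ t) = t.sub fun i => restrict k (ρ i) := by
  induction t with
  | var x => rcases x with x | x; exacts [x.elim, rfl]
  | func f ts ih =>
    simp only [restrict, substNat, Tm.sub, Language.Term.subst] at ih ⊢
    congr 1; funext i; exact ih i

theorem restrict_var {k i : ℕ} (h : i < k) : restrict k (.var i) = Tm.v ⟨i, h⟩ := by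
  simp [restrict, Language.Term.subst, h]

theorem weaken_restrict_var {k i : ℕ} (h : i < k) :
    (restrict k (.var i)).weaken = restrict (k + 1) (.var i) := by
  rw [restrict_var h, restrict_var (h.trans (Nat.lt_succ_self k))]
  rfl

/-- Once `k` exceeds every variable of `t`, nothing is replaced by `0` any more. -/
theorem eventually_weaken_restrict (t : lang.Term ℕ) :
    ∀ᶠ k in atTop, (restrict k t).weaken = restrict (k + 1) t := by
  induction t with
  | var i =>
    filter_upwards [eventually_gt_atTop i] with k hk
    exact weaken_restrict_var hk
  | func f ts ih =>
    filter_upwards [eventually_all.2 ih] with k hk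
    simp only [restrict, Language.Term.subst, Tm.weaken, Tm.sub] at hk ⊢
    congr 1; funext i; exact hk i

/-- A sequence of complete sets of formulas with increasingly many variables. -/
structure IsChain (Γ : ∀ n, Set (Fml n)) : Prop where
  isComplete : ∀ n, IsComplete (Γ n)
  weaken_mem : ∀ n, ∀ φ ∈ Γ n, φ.weaken ∈ Γ (n + 1)

/-- The formula `φ` holds at `ρ` in the limit of the sequence `Γ`. -/
def LimitTrue (Γ : ∀ n, Set (Fml n)) {n : ℕ} (φ : Fml n) (ρ : Fin n → lang.Term ℕ) : Prop :=
  ∀ᶠ k in atTop, φ.sub (fun i => restrict k (ρ i)) ∈ Γ k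

namespace IsChain

variable {Γ : ∀ n, Set (Fml n)}

/-- Each stage is conservative over the previous one: a formula missing from a complete set has its
negation there, and the negation persists. -/
theorem weaken_mem_iff (hΓ : IsChain Γ) {n : ℕ} {φ : Fml n} :
    φ.weaken ∈ Γ (n + 1) ↔ φ ∈ Γ n := by
  refine ⟨fun h => ?_, hΓ.weaken_mem n φ⟩
  by_contra h'
  have h₂ : (Fml.weaken φ ⟹ ⊥) ∈ Γ (n + 1) :=
    hΓ.weaken_mem n (∼φ) ((hΓ.isComplete n).not_mem.2 h')
  exact (hΓ.isComplete _).bot_notMem ((hΓ.isComplete _).mem_imp.1 h₂ h)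

/-- After the terms stabilize, successive formulas are weakenings of one another, so eventual truth
can be tested at the single stage `K`. -/
theorem mem_iff_of_le (hΓ : IsChain Γ) {n K : ℕ} {ρ : Fin n → lang.Term ℕ}
    (hK : ∀ k ≥ K, ∀ i, (restrict k (ρ i)).weaken = restrict (k + 1) (ρ i)) (φ : Fml n)
    {k : ℕ} (hk : K ≤ k) :
    φ.sub (fun i => restrict k (ρ i)) ∈ Γ k ↔ φ.sub (fun i => restrict K (ρ i)) ∈ Γ K := by
  induction k, hk using Nat.le_induction with
  | base => rfl
  | succ k hk ih =>
    rw [← ih, ← hΓ.weaken_mem_iff (n := k), Fml.weaken_sub, funext (hK k hk)]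

theorem limitTrue_iff (hΓ : IsChain Γ) {n K : ℕ} {ρ : Fin n → lang.Term ℕ}
    (hK : ∀ k ≥ K, ∀ i, (restrict k (ρ i)).weaken = restrict (k + 1) (ρ i)) (φ : Fml n) :
    LimitTrue Γ φ ρ ↔ φ.sub (fun i => restrict K (ρ i)) ∈ Γ K := by
  constructor
  · intro h
    obtain ⟨k, hk, h⟩ := ((eventually_ge_atTop K).and h).exists
    exact (hΓ.mem_iff_of_le hK φ hk).1 h
  · intro h
    filter_upwards [eventually_ge_atTop K] with k hk
    exact (hΓ.mem_iff_of_le hK φ hk).2 h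

theorem exists_bound {n : ℕ} (ρ : Fin n → lang.Term ℕ) :
    ∃ K, ∀ k ≥ K, ∀ i, (restrict k (ρ i)).weaken = restrict (k + 1) (ρ i) :=
  eventually_atTop.1 (eventually_all.2 fun i => eventually_weaken_restrict (ρ i))

theorem limitTrue_imp (hΓ : IsChain Γ) {n : ℕ} {ρ : Fin n → lang.Term ℕ} {φ ψ : Fml n} :
    LimitTrue Γ (φ ⟹ ψ) ρ ↔ (LimitTrue Γ φ ρ → LimitTrue Γ ψ ρ) := by
  obtain ⟨K, hK⟩ := exists_bound ρ
  rw [hΓ.limitTrue_iff hK, hΓ.limitTrue_iff hK, hΓ.limitTrue_iff hK]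
  exact (hΓ.isComplete K).mem_imp

theorem not_limitTrue_falsum (hΓ : IsChain Γ) {n : ℕ} {ρ : Fin n → lang.Term ℕ} :
    ¬ LimitTrue Γ .falsum ρ := by
  obtain ⟨K, hK⟩ := exists_bound ρ
  rw [hΓ.limitTrue_iff hK]
  exact (hΓ.isComplete K).bot_notMem

theorem limitTrue_snoc (hΓ : IsChain Γ) {n : ℕ} {ρ : Fin n → lang.Term ℕ} {φ : Fml (n + 1)}
    (h : LimitTrue Γ (∀' φ) ρ) (t : lang.Term ℕ) :
    LimitTrue Γ φ (Fin.snoc ρ t : Fin (n + 1) → lang.Term ℕ) := by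
  filter_upwards [h] with k hk
  have := (hΓ.isComplete k).inst_mem hk (restrict k t)
  -- The substitution under the quantifier is `Fml.up` only up to unfolding.
  erw [Fml.inst_sub_up] at this
  convert this using 2
  funext i
  refine Fin.lastCases ?_ (fun i => ?_) i <;> simp

/-- If the sequence has Henkin witnesses for `φ`, then a universal formula holds in the limit as
soon as all its instances by variables do. -/
theorem limitTrue_all (hΓ : IsChain Γ) {n : ℕ} {ρ : Fin n → lang.Term ℕ} {φ : Fml (n + 1)}
    (hφ : ∃ᶠ m in atTop, (φ.sub (Fml.up fun i => restrict m (ρ i)) ⟹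
      Fml.weaken (Fml.sub (fun i => restrict m (ρ i)) (∀' φ))) ∈ Γ (m + 1))
    (h : ∀ m, LimitTrue Γ φ (Fin.snoc ρ (.var m : lang.Term ℕ) : Fin (n + 1) → lang.Term ℕ)) :
    LimitTrue Γ (∀' φ) ρ := by
  obtain ⟨K, hK⟩ := exists_bound ρ
  -- The Henkin axiom must come at a stage where the parameters are already stable; otherwise it
  -- would concern truncated terms. This is why it is required infinitely often.
  obtain ⟨m, hm, hmK⟩ := (hφ.and_eventually (eventually_ge_atTop K)).exists
  have hK' : ∀ k ≥ m + 1, ∀ i,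
      (restrict k ((Fin.snoc ρ (.var m : lang.Term ℕ) : Fin (n + 1) → lang.Term ℕ) i)).weaken =
        restrict (k + 1) ((Fin.snoc ρ (.var m : lang.Term ℕ) : Fin (n + 1) → lang.Term ℕ) i) := by
    intro k hk i
    refine Fin.lastCases ?_ (fun i => ?_) i
    · simpa only [Fin.snoc_last] using weaken_restrict_var hk
    · simpa using hK k (by omega) i
  have h₁ := (hΓ.limitTrue_iff hK' φ).1 (h m)
  have e : (fun i => restrict (m + 1)
      ((Fin.snoc ρ (.var m : lang.Term ℕ) : Fin (n + 1) → lang.Term ℕ) i)) =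
      Fml.up fun i => restrict m (ρ i) := by
    funext i
    refine Fin.lastCases ?_ (fun i => ?_) i
    · simp only [Fml.up, Fin.snoc_last]
      exact restrict_var (Nat.lt_succ_self m)
    · simp [Fml.up, hK m hmK i]
  rw [e] at h₁
  have h₂ := hΓ.weaken_mem_iff.1 ((hΓ.isComplete _).mem_imp.1 hm h₁)
  rw [hΓ.limitTrue_iff hK]
  exact (hΓ.mem_iff_of_le hK _ hmK).1 h₂

/-- Equality of terms in the limit. -/
def setoid (hΓ : IsChain Γ) : Setoid (lang.Term ℕ) where
  r s t := ∀ᶠ k in atTop, (restrict k s =' restrict k t) ∈ Γ k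
  iseqv :=
    { refl := fun _ => Eventually.of_forall fun k => (hΓ.isComplete k).eq_refl_mem _
      symm := fun h => h.mono fun k hk => (hΓ.isComplete k).eq_symm_mem hk
      trans := fun h h' => (h.and h').mono fun k hk =>
        (hΓ.isComplete k).eq_trans_mem hk.1 hk.2 }

/-- The term model of a chain. -/
def Model (hΓ : IsChain Γ) : Type := Quotient hΓ.setoid

/-- The class of a term in the term model. -/
def toModel (hΓ : IsChain Γ) (t : lang.Term ℕ) : hΓ.Model := Quotient.mk hΓ.setoid t

theorem toModel_eq_iff (hΓ : IsChain Γ) {s t : lang.Term ℕ} :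
    hΓ.toModel s = hΓ.toModel t ↔ ∀ᶠ k in atTop, (restrict k s =' restrict k t) ∈ Γ k :=
  Quotient.eq (r := hΓ.setoid)

theorem toModel_surjective (hΓ : IsChain Γ) : Function.Surjective hΓ.toModel :=
  Quotient.mk_surjective

noncomputable instance (hΓ : IsChain Γ) : lang.Structure hΓ.Model where
  funMap f x := hΓ.toModel (.func f fun i => (x i).out)
  RelMap R _ := R.elim

/-- The representatives chosen in the structure do not matter, because eventual equality is a
congruence. -/
theorem funMap_toModel (hΓ : IsChain Γ) {l : ℕ} (f : lang.Functions l)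
    (ts : Fin l → lang.Term ℕ) :
    Language.Structure.funMap f (fun i => hΓ.toModel (ts i)) = hΓ.toModel (.func f ts) := by
  refine hΓ.toModel_eq_iff.2 ?_
  have : ∀ i, ∀ᶠ k in atTop,
      (restrict k (hΓ.toModel (ts i)).out =' restrict k (ts i)) ∈ Γ k :=
    fun i => Quotient.mk_out (s := hΓ.setoid) (ts i)
  filter_upwards [eventually_all.2 this] with k hk
  exact (hΓ.isComplete k).func_eq_mem f hk

theorem realize_toModel (hΓ : IsChain Γ) {n : ℕ} (ρ : Fin n → lang.Term ℕ) (t : Tm n)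
    (e : Empty → hΓ.Model) :
    t.realize (Sum.elim e fun i => hΓ.toModel (ρ i)) = hΓ.toModel (substNat ρ t) := by
  induction t with
  | var x => rcases x with x | x; exacts [x.elim, rfl]
  | func f ts ih =>
    simp only [Language.Term.realize, ih]
    exact hΓ.funMap_toModel f _

/-- The truth lemma. Every element of the model is the class of a term, so quantifying over the
model is quantifying over terms. -/
theorem realize_iff_limitTrue (hΓ : IsChain Γ)
    (hH : ∀ {n : ℕ} (ρ : Fin n → lang.Term ℕ) (φ : Fml (n + 1)),
      ∃ᶠ m in atTop, (φ.sub (Fml.up fun i => restrict m (ρ i)) ⟹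
        Fml.weaken (Fml.sub (fun i => restrict m (ρ i)) (∀' φ))) ∈ Γ (m + 1))
    {n : ℕ} (ρ : Fin n → lang.Term ℕ) (φ : Fml n) (e : Empty → hΓ.Model) :
    φ.Realize e (fun i => hΓ.toModel (ρ i)) ↔ LimitTrue Γ φ ρ := by
  induction φ with
  | falsum => exact iff_of_false id hΓ.not_limitTrue_falsum
  | equal t s =>
    simp only [Language.BoundedFormula.Realize, realize_toModel, toModel_eq_iff,
      restrict_substNat]
    rfl
  | rel R ts => exact R.elim
  | imp φ ψ ih₁ ih₂ =>
    rw [hΓ.limitTrue_imp, ← ih₁, ← ih₂]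
    rfl
  | all φ ih =>
    have key : ∀ t, (Fin.snoc (fun i => hΓ.toModel (ρ i)) (hΓ.toModel t) : Fin _ → hΓ.Model) =
        fun i => hΓ.toModel ((Fin.snoc ρ t : Fin _ → lang.Term ℕ) i) := fun t => by
      funext i
      refine Fin.lastCases ?_ (fun i => ?_) i <;> simp
    have : (∀' φ).Realize e (fun i => hΓ.toModel (ρ i)) ↔
        ∀ t, LimitTrue Γ φ (Fin.snoc ρ t : Fin _ → lang.Term ℕ) := by
      simp only [Language.BoundedFormula.realize_all, hΓ.toModel_surjective.forall, key, ih]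
    rw [this]
    exact ⟨fun h => hΓ.limitTrue_all (hH ρ φ) fun m => h _, fun h t => hΓ.limitTrue_snoc h t⟩

end IsChain

/-! ### Countability and the completeness theorem -/

instance : Countable lang.Symbols := by
  have h₁ : Countable (Σ l, lang.Functions l) := by
    have : Function.Surjective (fun i : Fin 4 => (![⟨0, Func.zero⟩, ⟨1, Func.succ⟩, ⟨2, Func.add⟩,
        ⟨2, Func.mul⟩] i : Σ l, Func l)) := by
      rintro ⟨_, f⟩
      cases f
      exacts [⟨0, rfl⟩, ⟨1, rfl⟩, ⟨2, rfl⟩, ⟨3, rfl⟩]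
    exact this.countable
  have h₂ : IsEmpty (Σ l, lang.Relations l) := ⟨fun x => x.2.elim⟩
  exact inferInstanceAs (Countable ((Σ l, lang.Functions l) ⊕ Σ l, lang.Relations l))

/-- The data of a universal formula and an assignment of terms to its free variables. -/
abbrev HenkinIndex : Type := Σ n, Fml (n + 1) × (Fin n → lang.Term ℕ)

theorem exists_frequent_enumeration : ∃ g : ℕ → HenkinIndex, ∀ p, ∃ᶠ m in atTop, g m = p := by
  have h₁ : Countable (Σ l, lang.Functions l) :=
    (Sum.inl_injective (β := Σ l, lang.Relations l)).countable (β := lang.Symbols)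
  have h₂ : ∀ n, Countable (Fml n) := fun n =>
    (sigma_mk_injective (β := fun n => lang.BoundedFormula Empty n) (i := n)).countable
  have : Nonempty HenkinIndex := ⟨⟨0, ⊥, Fin.elim0⟩⟩
  obtain ⟨g, hg⟩ := exists_surjective_nat HenkinIndex
  refine ⟨fun m => g m.unpair.1, fun p => frequently_atTop.2 fun b => ?_⟩
  obtain ⟨a, rfl⟩ := hg p
  -- Every index recurs beyond any bound `b`, with `b` as the second component.
  exact ⟨Nat.pair a b, Nat.right_le_pair a b, by simp⟩

/-- A consistent theory has a model. -/
theorem Consistent.exists_model {T : lang.Theory} (hT : Consistent (n := 0) T) :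
    ∃ (M : Type) (_ : lang.Structure M), ∀ A ∈ T, M ⊨ A := by
  obtain ⟨g, hg⟩ := exists_frequent_enumeration
  obtain ⟨Γ, h₀, hc, hw, hH⟩ := hT.exists_henkin_chain
    fun m => (g m).2.1.sub (Fml.up fun i => restrict m ((g m).2.2 i))
  have hΓ : IsChain Γ := ⟨hc, hw⟩
  refine ⟨hΓ.Model, inferInstance, fun A hA => ?_⟩
  have h := hΓ.realize_iff_limitTrue (fun {n} ρ φ => (hg ⟨n, φ, ρ⟩).mono fun m hm => by
    have := hH m
    rw [hm] at this
    exact this) Fin.elim0 A default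
  have hK : ∀ k ≥ 0, ∀ i : Fin 0,
      (restrict k (Fin.elim0 i)).weaken = restrict (k + 1) (Fin.elim0 i) := fun _ _ i => i.elim0
  have hA_true := h.2 ((hΓ.limitTrue_iff hK A).2 (by
    rw [Subsingleton.elim (fun i => restrict 0 (Fin.elim0 i)) fun i => Tm.v i, Fml.sub_id]
    exact h₀ hA))
  rw [Subsingleton.elim (fun i => hΓ.toModel (Fin.elim0 i)) default] at hA_true
  exact hA_true

/-- Gödel's completeness theorem. -/
theorem proves_of_forall_model {T : lang.Theory} {A : lang.Sentence}
    (h : ∀ (M : Type) [lang.Structure M], (∀ B ∈ T, M ⊨ B) → M ⊨ A) : Proves T A := by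
  refine .byContradiction ?_
  by_contra hc
  obtain ⟨M, _, hM⟩ := Consistent.exists_model (T := insert (∼A) T) hc
  have h₁ : M ⊨ A := h M fun B hB => hM B (Or.inr hB)
  have h₂ : M ⊨ (∼A : lang.Sentence) := hM _ (Or.inl rfl)
  exact (Language.Sentence.realize_not M).1 h₂ h₁

/-! ### Semantics of arithmetical formulas -/

/-- The value of a term in a structure. -/
def Tm.val {M : Type} [lang.Structure M] {n : ℕ} (t : Tm n) (xs : Fin n → M) : M :=
  t.realize (Sum.elim default xs)

/-- Satisfaction of a formula in a structure. -/
def Fml.Sat {M : Type} [lang.Structure M] {n : ℕ} (φ : Fml n) (xs : Fin n → M) : Prop :=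
  φ.Realize default xs

/-- `t < s`, that is `∃ z, z + S t = s`. -/
def Fml.lt {n : ℕ} (t s : Tm n) : Fml n :=
  ∃' (Tm.add (Tm.v (Fin.last n)) (Tm.succ t.weaken) =' s.weaken)

/-- Existential quantification over the last `n` variables. -/
def Fml.exsLast {m : ℕ} : (n : ℕ) → Fml (m + n) → Fml m
  | 0, φ => φ
  | n + 1, φ => exsLast n (∃' φ)

section Structure

variable {M : Type} [lang.Structure M]

/-- The value of `0` in a structure. -/
def mzero (M : Type) [lang.Structure M] : M := Language.Structure.funMap (L := lang) Func.zero ![]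

/-- The successor function of a structure. -/
def msucc (a : M) : M := Language.Structure.funMap (L := lang) Func.succ ![a]

/-- The addition of a structure. -/
def madd (a b : M) : M := Language.Structure.funMap (L := lang) Func.add ![a, b]

/-- The multiplication of a structure. -/
def mmul (a b : M) : M := Language.Structure.funMap (L := lang) Func.mul ![a, b]

/-- The value of a numeral in a structure. -/
def mnum (M : Type) [lang.Structure M] : ℕ → M
  | 0 => mzero M
  | x + 1 => msucc (mnum M x)

/-- The order of a structure that is defined by `Fml.lt`. -/
def mlt (a b : M) : Prop := ∃ z, madd z (msucc a) = b

variable {n : ℕ} (xs : Fin n → M)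

@[simp] theorem Tm.val_v (i : Fin n) : (Tm.v i).val xs = xs i := rfl

@[simp] theorem Tm.val_zero : (Tm.zero : Tm n).val xs = mzero M := by
  simp only [Tm.val, Tm.zero, Language.Constants.term, Language.Term.realize, mzero]
  congr 1; exact Subsingleton.elim _ _

@[simp] theorem Tm.val_succ (t : Tm n) : t.succ.val xs = msucc (t.val xs) :=
  Language.Term.realize_functions_apply₁

@[simp] theorem Tm.val_add (t s : Tm n) : (t.add s).val xs = madd (t.val xs) (s.val xs) :=
  Language.Term.realize_functions_apply₂

@[simp] theorem Tm.val_mul (t s : Tm n) : (t.mul s).val xs = mmul (t.val xs) (s.val xs) :=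
  Language.Term.realize_functions_apply₂

@[simp] theorem Tm.val_num (x : ℕ) : (Tm.num x : Tm n).val xs = mnum M x := by
  induction x with
  | zero => exact Tm.val_zero xs
  | succ x ih => exact (Tm.val_succ xs _).trans (congrArg msucc ih)

theorem Tm.val_sub {m : ℕ} (σ : Fin m → Tm n) (t : Tm m) :
    (t.sub σ).val xs = t.val fun i => (σ i).val xs := by
  rw [Tm.val, Tm.sub, Language.Term.realize_subst, Tm.val]
  congr 1; funext a
  rcases a with a | a
  exacts [a.elim, rfl]

@[simp] theorem Tm.val_weaken (t : Tm n) (a : M) :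
    t.weaken.val (Fin.snoc xs a : Fin (n + 1) → M) = t.val xs := by
  simp [Tm.weaken, Tm.val_sub]

theorem val_snoc {m : ℕ} (σ : Fin m → Tm n) (t : Tm n) :
    (fun i => ((Fin.snoc σ t : Fin (m + 1) → Tm n) i).val xs) =
      (Fin.snoc (fun i => (σ i).val xs) (t.val xs) : Fin (m + 1) → M) := by
  funext i
  refine Fin.lastCases ?_ (fun i => ?_) i <;> simp

namespace Fml

@[simp] theorem sat_eq (t s : Tm n) : Sat (t =' s) xs ↔ t.val xs = s.val xs := Iff.rfl

@[simp] theorem sat_imp (φ ψ : Fml n) : Sat (φ ⟹ ψ) xs ↔ (Sat φ xs → Sat ψ xs) := Iff.rfl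

@[simp] theorem sat_not (φ : Fml n) : Sat (∼φ) xs ↔ ¬ Sat φ xs := Iff.rfl

@[simp] theorem sat_all (φ : Fml (n + 1)) :
    Sat (∀' φ) xs ↔ ∀ a : M, Sat φ (Fin.snoc xs a : Fin (n + 1) → M) := Iff.rfl

@[simp] theorem sat_ex (φ : Fml (n + 1)) :
    Sat (∃' φ) xs ↔ ∃ a : M, Sat φ (Fin.snoc xs a : Fin (n + 1) → M) :=
  Language.BoundedFormula.realize_ex

@[simp] theorem sat_inf (φ ψ : Fml n) : Sat (φ ⊓ ψ) xs ↔ Sat φ xs ∧ Sat ψ xs :=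
  Language.BoundedFormula.realize_inf

@[simp] theorem sat_sup (φ ψ : Fml n) : Sat (φ ⊔ ψ) xs ↔ Sat φ xs ∨ Sat ψ xs :=
  Language.BoundedFormula.realize_sup

@[simp] theorem sat_iInf {ι : Type} [Finite ι] (φ : ι → Fml n) :
    Sat (Language.BoundedFormula.iInf φ) xs ↔ ∀ i, Sat (φ i) xs :=
  Language.BoundedFormula.realize_iInf

theorem sat_sub {n m : ℕ} (σ : Fin m → Tm n) (φ : Fml m) (xs : Fin n → M) :
    Sat (φ.sub σ) xs ↔ φ.Sat fun i => (σ i).val xs := by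
  induction φ generalizing n with
  | falsum => rfl
  | equal t s => exact Iff.of_eq (congrArg₂ _ (Tm.val_sub xs σ t) (Tm.val_sub xs σ s))
  | rel R ts => exact R.elim
  | imp φ ψ ih₁ ih₂ => exact imp_congr (ih₁ σ xs) (ih₂ σ xs)
  | all φ ih =>
    refine forall_congr' fun a => (ih _ _).trans ?_
    simp only [val_snoc, Tm.val_weaken, Tm.val_v, Fin.snoc_last]
    rfl

@[simp] theorem sat_lt (t s : Tm n) : Sat (lt t s) xs ↔ mlt (t.val xs) (s.val xs) := by
  simp [lt, mlt]

theorem sat_exsLast {m : ℕ} (xs : Fin m → M) (n : ℕ) (φ : Fml (m + n)) :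
    Sat (exsLast n φ) xs ↔ ∃ ys : Fin n → M, Sat φ (Fin.append xs ys) := by
  induction n with
  | zero =>
    rw [Unique.exists_iff, Fin.append_right_nil _ _ rfl]
    rfl
  | succ n ih =>
    rw [exsLast, ih]
    simp only [sat_ex]
    constructor
    · rintro ⟨ys, a, h⟩
      refine ⟨Fin.snoc ys a, ?_⟩
      rwa [Fin.append_snoc]
    · rintro ⟨ys, h⟩
      refine ⟨Fin.init ys, ys (Fin.last n), ?_⟩
      rwa [← Fin.append_snoc, Fin.snoc_init_self]

end Fml

end Structure

/-! ### Order and numerals in models of Q -/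

/-- Models of Robinson Arithmetic. -/
structure IsQModel (M : Type) [lang.Structure M] : Prop where
  succ_ne_zero : ∀ a : M, msucc a ≠ mzero M
  succ_inj : ∀ a b : M, msucc a = msucc b → a = b
  eq_zero_or_succ : ∀ a : M, a = mzero M ∨ ∃ b, msucc b = a
  add_zero : ∀ a : M, madd a (mzero M) = a
  add_succ : ∀ a b : M, madd a (msucc b) = msucc (madd a b)
  mul_zero : ∀ a : M, mmul a (mzero M) = mzero M
  mul_succ : ∀ a b : M, mmul a (msucc b) = madd a (mmul a b)

theorem snoc_snoc_zero {M : Type} (e : Fin 0 → M) (a b : M) :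
    (Fin.snoc (Fin.snoc e a : Fin 1 → M) b : Fin 2 → M) 0 = a := rfl

theorem snoc_snoc_one {M : Type} (e : Fin 0 → M) (a b : M) :
    (Fin.snoc (Fin.snoc e a : Fin 1 → M) b : Fin 2 → M) 1 = b := rfl

theorem snoc_zero {M : Type} (e : Fin 0 → M) (a : M) : (Fin.snoc e a : Fin 1 → M) 0 = a := rfl

theorem isQModel_of_models {M : Type} [lang.Structure M] (h : ∀ A ∈ Q, M ⊨ A) : IsQModel M := by
  have h' : ∀ A, QAxiom A → Fml.Sat A (default : Fin 0 → M) := h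
  constructor
  · simpa [snoc_zero] using h' _ .S0
  · simpa [snoc_snoc_zero, snoc_snoc_one, snoc_zero] using h' _ .S1
  · simpa [snoc_snoc_zero, snoc_snoc_one, snoc_zero] using h' _ .S2
  · simpa [snoc_zero] using h' _ .A0
  · simpa [snoc_snoc_zero, snoc_snoc_one, snoc_zero] using h' _ .A1
  · simpa [snoc_zero] using h' _ .M0
  · simpa [snoc_snoc_zero, snoc_snoc_one, snoc_zero] using h' _ .M1

namespace IsQModel

variable {M : Type} [lang.Structure M]

theorem num_add (hM : IsQModel M) (a b : ℕ) : madd (mnum M a) (mnum M b) = mnum M (a + b) := by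
  induction b with
  | zero => exact hM.add_zero _
  | succ b ih => exact (hM.add_succ _ _).trans (congrArg msucc ih)

theorem num_mul (hM : IsQModel M) (a b : ℕ) : mmul (mnum M a) (mnum M b) = mnum M (a * b) := by
  induction b with
  | zero => exact hM.mul_zero _
  | succ b ih =>
    refine (hM.mul_succ _ _).trans ?_
    rw [ih, hM.num_add, Nat.mul_succ, Nat.add_comm]

theorem num_injective (hM : IsQModel M) : Function.Injective (mnum M) := by
  intro a b h
  induction a generalizing b with
  | zero =>
    cases b with
    | zero => rfl
    | succ b => exact (hM.succ_ne_zero _ h.symm).elim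
  | succ a ih =>
    cases b with
    | zero => exact (hM.succ_ne_zero _ h).elim
    | succ b => rw [ih (hM.succ_inj _ _ h)]

/-- Addition recurses on its right argument, so successors can be stripped from `a` and the numeral
together, at most `b` times. Hence `t < s` is defined with `S t` on the right of the sum. -/
theorem exists_num_of_add_eq (hM : IsQModel M) {b : ℕ} {z a : M} (h : madd z a = mnum M b) :
    ∃ c ≤ b, a = mnum M c := by
  induction b generalizing a with
  | zero =>
    rcases hM.eq_zero_or_succ a with rfl | ⟨a, rfl⟩
    · exact ⟨0, le_rfl, rfl⟩
    · rw [hM.add_succ] at h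
      exact (hM.succ_ne_zero _ h).elim
  | succ b ih =>
    rcases hM.eq_zero_or_succ a with rfl | ⟨a, rfl⟩
    · exact ⟨0, Nat.zero_le _, rfl⟩
    · rw [hM.add_succ] at h
      obtain ⟨c, hc, rfl⟩ := ih (hM.succ_inj _ _ h)
      exact ⟨c + 1, Nat.succ_le_succ hc, rfl⟩

theorem lt_num_iff (hM : IsQModel M) {a : M} {b : ℕ} :
    mlt a (mnum M b) ↔ ∃ c < b, a = mnum M c := by
  constructor
  · rintro ⟨z, h⟩
    obtain ⟨c, hc, e⟩ := hM.exists_num_of_add_eq h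
    cases c with
    | zero => exact (hM.succ_ne_zero _ e).elim
    | succ c => exact ⟨c, hc, hM.succ_inj _ _ e⟩
  · rintro ⟨c, hc, rfl⟩
    refine ⟨mnum M (b - (c + 1)), (hM.num_add _ (c + 1)).trans ?_⟩
    rw [Nat.sub_add_cancel hc]

theorem num_lt_num_iff (hM : IsQModel M) {a b : ℕ} : mlt (mnum M a) (mnum M b) ↔ a < b := by
  rw [hM.lt_num_iff]
  constructor
  · rintro ⟨c, hc, e⟩
    rwa [hM.num_injective e]
  · exact fun h => ⟨a, h, rfl⟩

theorem trichotomy (hM : IsQModel M) (b : ℕ) (a : M) :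
    mlt a (mnum M b) ∨ a = mnum M b ∨ mlt (mnum M b) a := by
  -- Taking predecessors of `a` either reaches `0` in fewer than `b` steps or succeeds `b` times.
  have key : (∃ c < b, a = mnum M c) ∨ ∃ z, madd z (mnum M b) = a := by
    induction b generalizing a with
    | zero => exact Or.inr ⟨a, hM.add_zero a⟩
    | succ b ih =>
      rcases hM.eq_zero_or_succ a with rfl | ⟨a, rfl⟩
      · exact Or.inl ⟨0, Nat.succ_pos b, rfl⟩
      · rcases ih a with ⟨c, hc, rfl⟩ | ⟨z, rfl⟩
        · exact Or.inl ⟨c + 1, Nat.succ_lt_succ hc, rfl⟩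
        · exact Or.inr ⟨z, hM.add_succ _ _⟩
  rcases key with h | ⟨z, rfl⟩
  · exact Or.inl (hM.lt_num_iff.2 h)
  · rcases hM.eq_zero_or_succ z with rfl | ⟨z, rfl⟩
    · exact Or.inr (Or.inl ((hM.num_add 0 b).trans (by rw [Nat.zero_add])))
    · refine Or.inr (Or.inr ⟨z, ?_⟩)
      -- The identity `z + S b = S z + b` is proved by external induction, which is available
      -- because `b` is a numeral.
      change madd z (mnum M (b + 1)) = _
      induction b with
      | zero => exact (hM.add_succ _ _).trans (by rw [mnum, hM.add_zero, hM.add_zero])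
      | succ b ih =>
        rw [mnum, hM.add_succ, ih]
        exact (hM.add_succ _ _).symm

end IsQModel

/-! ### Definability at numerals and its closure properties -/

/-- The formula `φ` defines the partial function `f` at all numerals in its domain, in every model
of Robinson Arithmetic. -/
def Defines {k : ℕ} (φ : Fml (k + 1)) (f : (Fin k → ℕ) →. ℕ) : Prop :=
  ∀ (M : Type) [lang.Structure M], IsQModel M → ∀ x, ∀ y ∈ f x, ∀ a : M,
    φ.Sat (Fin.snoc (fun i => mnum M (x i)) a : Fin (k + 1) → M) ↔ a = mnum M y

/-- The partial function `f` is defined at all numerals by a single formula. -/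
def IsRep {k : ℕ} (f : (Fin k → ℕ) →. ℕ) : Prop := ∃ φ : Fml (k + 1), Defines φ f

/-- The total function `f` is defined at all numerals by a single formula. -/
def IsRepFun {k : ℕ} (f : (Fin k → ℕ) → ℕ) : Prop := IsRep fun x => Part.some (f x)

/-- The relation `R` is decided at all numerals by a single formula. -/
def IsRepRel {k : ℕ} (R : (Fin k → ℕ) → Prop) : Prop :=
  ∃ φ : Fml k, ∀ (M : Type) [lang.Structure M], IsQModel M → ∀ x,
    φ.Sat (fun i => mnum M (x i)) ↔ R x

theorem num_comp_snoc {M : Type} [lang.Structure M] {k : ℕ} (x : Fin k → ℕ) (y : ℕ) :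
    (Fin.snoc (fun i => mnum M (x i)) (mnum M y) : Fin (k + 1) → M) =
      fun i => mnum M ((Fin.snoc x y : Fin (k + 1) → ℕ) i) := by
  funext i
  refine Fin.lastCases ?_ (fun i => ?_) i <;> simp

/-- The inner formulas force the quantified intermediate values to be numerals, so the outer formula
is only evaluated at numerals. -/
theorem IsRep.comp {m n : ℕ} {f : (Fin n → ℕ) →. ℕ} {g : Fin n → (Fin m → ℕ) →. ℕ}
    {h : (Fin m → ℕ) →. ℕ} (hf : IsRep f) (hg : ∀ i, IsRep (g i))
    (hh : ∀ x, ∀ y ∈ h x, ∃ z : Fin n → ℕ, (∀ i, z i ∈ g i x) ∧ y ∈ f z) : IsRep h := by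
  obtain ⟨φ, hφ⟩ := hf
  choose ψ hψ using hg
  refine ⟨Fml.exsLast n
    (Language.BoundedFormula.iInf (fun i => (ψ i).sub
        (Fin.snoc (fun j => Tm.v (Fin.castAdd n j.castSucc)) (Tm.v (Fin.natAdd (m + 1) i)))) ⊓
      φ.sub (Fin.snoc (fun i => Tm.v (Fin.natAdd (m + 1) i))
        (Tm.v (Fin.castAdd n (Fin.last m))))), fun M _ hM x y hy a => ?_⟩
  obtain ⟨z, hz, hyz⟩ := hh x y hy
  simp only [Fml.sat_exsLast, Fml.sat_inf, Fml.sat_iInf, Fml.sat_sub, val_snoc, Tm.val_v,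
    Fin.append_left, Fin.append_right, Fin.snoc_castSucc, Fin.snoc_last, hψ _ M hM x _ (hz _)]
  constructor
  · rintro ⟨ys, h₁, h₂⟩
    rw [funext h₁] at h₂
    exact (hφ M hM z y hyz a).1 h₂
  · rintro rfl
    exact ⟨_, fun _ => rfl, (hφ M hM z y hyz _).2 rfl⟩

theorem IsRepFun.comp {m n : ℕ} {f : (Fin n → ℕ) → ℕ} {g : Fin n → (Fin m → ℕ) → ℕ}
    (hf : IsRepFun f) (hg : ∀ i, IsRepFun (g i)) : IsRepFun fun x => f fun i => g i x :=
  IsRep.comp hf hg fun x _ hy => ⟨fun i => g i x, fun _ => Part.mem_some _, hy⟩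

theorem IsRepRel.comp {m n : ℕ} {R : (Fin n → ℕ) → Prop} {g : Fin n → (Fin m → ℕ) → ℕ}
    (hR : IsRepRel R) (hg : ∀ i, IsRepFun (g i)) : IsRepRel fun x => R fun i => g i x := by
  obtain ⟨φ, hφ⟩ := hR
  choose ψ hψ using hg
  refine ⟨Fml.exsLast n
    (Language.BoundedFormula.iInf (fun i => (ψ i).sub
        (Fin.snoc (fun j => Tm.v (Fin.castAdd n j)) (Tm.v (Fin.natAdd m i)))) ⊓
      φ.sub (fun i => Tm.v (Fin.natAdd m i))), fun M _ hM x => ?_⟩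
  simp only [Fml.sat_exsLast, Fml.sat_inf, Fml.sat_iInf, Fml.sat_sub, val_snoc, Tm.val_v,
    Fin.append_left, Fin.append_right, hψ _ M hM x _ (Part.mem_some _), ← hφ M hM]
  constructor
  · rintro ⟨ys, h₁, h₂⟩
    rwa [funext h₁] at h₂
  · exact fun h => ⟨_, fun _ => rfl, h⟩

/-- Minimization of a decided relation. -/
theorem IsRepRel.isRep_of_least {k : ℕ} {R : (Fin k → ℕ) → ℕ → Prop} {f : (Fin k → ℕ) →. ℕ}
    (hR : IsRepRel fun z : Fin (k + 1) → ℕ => R (Fin.init z) (z (Fin.last k)))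
    (hf : ∀ x, ∀ y ∈ f x, R x y ∧ ∀ z < y, ¬ R x z) : IsRep f := by
  obtain ⟨φ, hφ⟩ := hR
  refine ⟨φ ⊓ ∀' (Fml.lt (Tm.v (Fin.last (k + 1))) (Tm.v (Fin.last k).castSucc) ⟹
    ∼(φ.sub (Fin.snoc (fun i => Tm.v i.castSucc.castSucc) (Tm.v (Fin.last (k + 1)))))),
    fun M _ hM x y hy a => ?_⟩
  obtain ⟨h₁, h₂⟩ := hf x y hy
  have key : ∀ z, φ.Sat (Fin.snoc (fun i => mnum M (x i)) (mnum M z) : Fin (k + 1) → M) ↔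
      R x z := fun z => by
    rw [num_comp_snoc, hφ M hM]
    simp
  simp only [Fml.sat_inf, Fml.sat_all, Fml.sat_imp, Fml.sat_not, Fml.sat_lt, Fml.sat_sub,
    val_snoc, Tm.val_v, Fin.snoc_last, Fin.snoc_castSucc]
  constructor
  · rintro ⟨h₃, h₄⟩
    -- An element below the value is a smaller numeral, where the relation fails; one above it
    -- violates leastness, witnessed by the value itself.
    rcases hM.trichotomy y a with h | h | h
    · obtain ⟨c, hc, rfl⟩ := hM.lt_num_iff.1 h
      exact (h₂ c hc ((key c).1 h₃)).elim
    · exact h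
    · exact (h₄ _ h ((key y).2 h₁)).elim
  · rintro rfl
    refine ⟨(key y).2 h₁, fun b hb => ?_⟩
    obtain ⟨c, hc, rfl⟩ := hM.lt_num_iff.1 hb
    exact fun h => h₂ c hc ((key c).1 h)

theorem IsRepRel.isRepFun_of_least {k : ℕ} {R : (Fin k → ℕ) → ℕ → Prop} {f : (Fin k → ℕ) → ℕ}
    (hR : IsRepRel fun z : Fin (k + 1) → ℕ => R (Fin.init z) (z (Fin.last k)))
    (hf : ∀ x, R x (f x)) (hmin : ∀ x, ∀ z < f x, ¬ R x z) : IsRepFun f :=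
  hR.isRep_of_least fun x y hy => by
    obtain rfl := Part.mem_some_iff.1 hy
    exact ⟨hf x, hmin x⟩

theorem IsRepRel.isRepFun_of_unique {k : ℕ} {R : (Fin k → ℕ) → ℕ → Prop} {f : (Fin k → ℕ) → ℕ}
    (hR : IsRepRel fun z : Fin (k + 1) → ℕ => R (Fin.init z) (z (Fin.last k)))
    (hf : ∀ x y, R x y ↔ y = f x) : IsRepFun f :=
  hR.isRepFun_of_least (fun x => (hf x _).2 rfl) fun x _ hz h => hz.ne ((hf x _).1 h)

theorem isRepFun_proj {k : ℕ} (i : Fin k) : IsRepFun fun x => x i := by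
  refine ⟨Tm.v (Fin.last k) =' Tm.v i.castSucc, fun M _ hM x y hy a => ?_⟩
  obtain rfl := Part.mem_some_iff.1 hy
  simp

theorem isRepFun_const {k : ℕ} (c : ℕ) : IsRepFun fun _ : Fin k → ℕ => c := by
  refine ⟨Tm.v (Fin.last k) =' Tm.num c, fun M _ hM x y hy a => ?_⟩
  obtain rfl := Part.mem_some_iff.1 hy
  simp

section

variable {k : ℕ} {f g : (Fin k → ℕ) → ℕ}

theorem IsRepFun.comp_two {F : ℕ → ℕ → ℕ} (hF : IsRepFun fun x : Fin 2 → ℕ => F (x 0) (x 1))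
    (hf : IsRepFun f) (hg : IsRepFun g) : IsRepFun fun x => F (f x) (g x) :=
  hF.comp (g := ![f, g]) (Fin.forall_fin_two.2 ⟨hf, hg⟩)

theorem IsRepRel.comp_two {R : ℕ → ℕ → Prop} (hR : IsRepRel fun x : Fin 2 → ℕ => R (x 0) (x 1))
    (hf : IsRepFun f) (hg : IsRepFun g) : IsRepRel fun x => R (f x) (g x) :=
  hR.comp (g := ![f, g]) (Fin.forall_fin_two.2 ⟨hf, hg⟩)

theorem IsRepFun.add (hf : IsRepFun f) (hg : IsRepFun g) : IsRepFun fun x => f x + g x := by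
  refine IsRepFun.comp_two (F := (· + ·)) ⟨Tm.v (Fin.last 2) =' Tm.add (Tm.v (0 : Fin 2).castSucc)
    (Tm.v (1 : Fin 2).castSucc), fun M _ hM x y hy a => ?_⟩ hf hg
  obtain rfl := Part.mem_some_iff.1 hy
  simp only [Fml.sat_eq, Tm.val_add, Tm.val_v, Fin.snoc_last, Fin.snoc_castSucc, hM.num_add]

theorem IsRepFun.mul (hf : IsRepFun f) (hg : IsRepFun g) : IsRepFun fun x => f x * g x := by
  refine IsRepFun.comp_two (F := (· * ·)) ⟨Tm.v (Fin.last 2) =' Tm.mul (Tm.v (0 : Fin 2).castSucc)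
    (Tm.v (1 : Fin 2).castSucc), fun M _ hM x y hy a => ?_⟩ hf hg
  obtain rfl := Part.mem_some_iff.1 hy
  simp only [Fml.sat_eq, Tm.val_mul, Tm.val_v, Fin.snoc_last, Fin.snoc_castSucc, hM.num_mul]

theorem IsRepRel.eq (hf : IsRepFun f) (hg : IsRepFun g) : IsRepRel fun x => f x = g x :=
  IsRepRel.comp_two (R := (· = ·)) ⟨Tm.v 0 =' Tm.v 1, fun _ _ hM _ => hM.num_injective.eq_iff⟩ hf hg

theorem IsRepRel.lt (hf : IsRepFun f) (hg : IsRepFun g) : IsRepRel fun x => f x < g x :=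
  IsRepRel.comp_two (R := (· < ·)) ⟨Fml.lt (Tm.v 0) (Tm.v 1), fun _ _ hM _ =>
    (Fml.sat_lt _ _ _).trans hM.num_lt_num_iff⟩ hf hg

variable {R S : (Fin k → ℕ) → Prop}

theorem IsRepRel.not (hR : IsRepRel R) : IsRepRel fun x => ¬ R x := by
  obtain ⟨φ, hφ⟩ := hR
  exact ⟨∼φ, fun M _ hM x => not_congr (hφ M hM x)⟩

theorem IsRepRel.and (hR : IsRepRel R) (hS : IsRepRel S) : IsRepRel fun x => R x ∧ S x := by
  obtain ⟨φ, hφ⟩ := hR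
  obtain ⟨ψ, hψ⟩ := hS
  exact ⟨φ ⊓ ψ, fun M _ hM x => (Fml.sat_inf _ _ _).trans (and_congr (hφ M hM x) (hψ M hM x))⟩

theorem IsRepRel.or (hR : IsRepRel R) (hS : IsRepRel S) : IsRepRel fun x => R x ∨ S x := by
  obtain ⟨φ, hφ⟩ := hR
  obtain ⟨ψ, hψ⟩ := hS
  exact ⟨φ ⊔ ψ, fun M _ hM x => (Fml.sat_sup _ _ _).trans (or_congr (hφ M hM x) (hψ M hM x))⟩

/-- Bounded universal quantification. -/
theorem IsRepRel.ball {P : (Fin k → ℕ) → ℕ → Prop}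
    (hP : IsRepRel fun z : Fin (k + 1) → ℕ => P (Fin.init z) (z (Fin.last k)))
    (hf : IsRepFun f) : IsRepRel fun x => ∀ i < f x, P x i := by
  obtain ⟨φ, hφ⟩ := hP
  obtain ⟨ψ, hψ⟩ := hf
  refine ⟨∃' (ψ ⊓ ∀' (Fml.lt (Tm.v (Fin.last (k + 1))) (Tm.v (Fin.last k).castSucc) ⟹
    φ.sub (Fin.snoc (fun i => Tm.v i.castSucc.castSucc) (Tm.v (Fin.last (k + 1)))))),
    fun M _ hM x => ?_⟩
  have key : ∀ z, φ.Sat (Fin.snoc (fun i => mnum M (x i)) (mnum M z) : Fin (k + 1) → M) ↔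
      P x z := fun z => by
    rw [num_comp_snoc, hφ M hM]
    simp
  simp only [Fml.sat_ex, Fml.sat_inf, hψ M hM x _ (Part.mem_some _), exists_eq_left, Fml.sat_all,
    Fml.sat_imp, Fml.sat_lt, Fml.sat_sub, val_snoc, Tm.val_v, Fin.snoc_last, Fin.snoc_castSucc]
  constructor
  · exact fun h i hi => (key i).1 (h _ (hM.num_lt_num_iff.2 hi))
  · intro h a ha
    obtain ⟨c, hc, rfl⟩ := hM.lt_num_iff.1 ha
    exact (key c).2 (h c hc)

/-- Bounded existential quantification. -/
theorem IsRepRel.bex {P : (Fin k → ℕ) → ℕ → Prop}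
    (hP : IsRepRel fun z : Fin (k + 1) → ℕ => P (Fin.init z) (z (Fin.last k)))
    (hf : IsRepFun f) : IsRepRel fun x => ∃ i < f x, P x i := by
  have h := (IsRepRel.ball (P := fun x i => ¬ P x i) hP.not hf).not
  simpa using h

end

/-! ### Pairing, remainders and the beta function -/

section

variable {k : ℕ} {f g h : (Fin k → ℕ) → ℕ}

theorem IsRepRel.pair_eq (hf : IsRepFun f) (hg : IsRepFun g) (hh : IsRepFun h) :
    IsRepRel fun x => Nat.pair (f x) (g x) = h x := by
  have H := ((IsRepRel.lt hf hg).and (.eq ((hg.mul hg).add hf) hh)).or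
    ((IsRepRel.lt hf hg).not.and (.eq (((hf.mul hf).add hf).add hg) hh))
  -- The two disjuncts are the two polynomial branches of `Nat.pair`.
  refine cast (congrArg _ (funext fun x => propext ?_)) H
  by_cases hlt : f x < g x <;> simp [Nat.pair, hlt]

theorem IsRepFun.comp_one {F : ℕ → ℕ} (hF : IsRepFun fun x : Fin 1 → ℕ => F (x 0))
    (hf : IsRepFun f) : IsRepFun fun x => F (f x) :=
  hF.comp (g := fun _ => f) fun _ => hf

theorem IsRepFun.unpair_fst (hf : IsRepFun f) : IsRepFun fun x => (f x).unpair.1 := by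
  refine IsRepFun.comp_one (F := fun c => c.unpair.1) (IsRepRel.isRepFun_of_unique
    (R := fun x a => ∃ b < x 0 + 1, Nat.pair a b = x 0) (IsRepRel.bex
      (P := fun z b => Nat.pair (z (Fin.last 1)) b = z 0)
      (.pair_eq (isRepFun_proj (Fin.last 1).castSucc) (isRepFun_proj (Fin.last 2))
        (isRepFun_proj 0)) ((isRepFun_proj 0).add (isRepFun_const 1))) fun x a => ?_) hf
  constructor
  · rintro ⟨b, -, hb⟩
    simp [← hb]
  · rintro rfl
    exact ⟨(x 0).unpair.2, Nat.lt_succ_of_le (Nat.unpair_right_le _), Nat.pair_unpair _⟩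

theorem IsRepFun.unpair_snd (hf : IsRepFun f) : IsRepFun fun x => (f x).unpair.2 := by
  refine IsRepFun.comp_one (F := fun c => c.unpair.2) (IsRepRel.isRepFun_of_unique
    (R := fun x b => ∃ a < x 0 + 1, Nat.pair a b = x 0) (IsRepRel.bex
      (P := fun z a => Nat.pair a (z (Fin.last 1)) = z 0)
      (.pair_eq (isRepFun_proj (Fin.last 2)) (isRepFun_proj (Fin.last 1).castSucc)
        (isRepFun_proj 0)) ((isRepFun_proj 0).add (isRepFun_const 1))) fun x a => ?_) hf
  constructor
  · rintro ⟨b, -, hb⟩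
    simp [← hb]
  · rintro rfl
    exact ⟨(x 0).unpair.1, Nat.lt_succ_of_le (Nat.unpair_left_le _), Nat.pair_unpair _⟩

/-- Division with remainder, the quotient being bounded by the dividend. A successor modulus avoids
division by zero and is all that `Nat.beta` needs. -/
theorem IsRepFun.mod_succ (hf : IsRepFun f) (hg : IsRepFun g) :
    IsRepFun fun x => f x % (g x + 1) := by
  refine IsRepFun.comp_two (F := fun a b => a % (b + 1)) (IsRepRel.isRepFun_of_unique
    (R := fun x r => r < x 1 + 1 ∧ ∃ q < x 0 + 1, (x 1 + 1) * q + r = x 0)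
    ((IsRepRel.lt (isRepFun_proj (Fin.last 2)) ((isRepFun_proj 1).add (isRepFun_const 1))).and
      (IsRepRel.bex (P := fun z q => (z 1 + 1) * q + z (Fin.last 2) = z 0)
        (.eq ((((isRepFun_proj 1).add (isRepFun_const 1)).mul (isRepFun_proj (Fin.last 3))).add
          (isRepFun_proj (Fin.last 2).castSucc)) (isRepFun_proj 0))
        ((isRepFun_proj 0).add (isRepFun_const 1)))) fun x r => ?_) hf hg
  constructor
  · rintro ⟨hr, q, -, hq⟩
    rw [← hq, Nat.mul_add_mod, Nat.mod_eq_of_lt hr]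
  · rintro rfl
    exact ⟨Nat.mod_lt _ (Nat.succ_pos _), x 0 / (x 1 + 1),
      Nat.lt_succ_of_le (Nat.div_le_self _ _), Nat.div_add_mod _ _⟩

theorem IsRepFun.beta (hf : IsRepFun f) (hg : IsRepFun g) :
    IsRepFun fun x => Nat.beta (f x) (g x) :=
  hf.unpair_fst.mod_succ ((hg.add (isRepFun_const 1)).mul hf.unpair_snd)

end

/-! ### Primitive recursion by coding sequences -/

theorem exists_beta_eq (s : ℕ → ℕ) (n : ℕ) : ∃ c, ∀ i ≤ n, Nat.beta c i = s i := by
  refine ⟨Nat.unbeta ((List.range (n + 1)).map s), fun i hi => ?_⟩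
  have := Nat.beta_unbeta_coe ((List.range (n + 1)).map s) ⟨i, by simp; omega⟩
  simpa using this

/-- The function defined from `f` and `g` by primitive recursion on the first argument. -/
def precFun {n : ℕ} (f : (Fin n → ℕ) → ℕ) (g : (Fin (n + 2) → ℕ) → ℕ) (x : Fin (n + 1) → ℕ) : ℕ :=
  Nat.rec (f (Fin.tail x))
    (fun y ih => g (Fin.cons y (Fin.cons ih (Fin.tail x) : Fin (n + 1) → ℕ))) (x 0)

/-- `c` codes the values of the function defined from `f` and `g` by primitive recursion. -/
def IsPrecCode {n : ℕ} (f : (Fin n → ℕ) → ℕ) (g : (Fin (n + 2) → ℕ) → ℕ) (x : Fin (n + 1) → ℕ)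
    (c : ℕ) : Prop :=
  Nat.beta c 0 = f (Fin.tail x) ∧ ∀ i < x 0, Nat.beta c (i + 1) =
    g (Fin.cons i (Fin.cons (Nat.beta c i) (Fin.tail x) : Fin (n + 1) → ℕ))

section

variable {n : ℕ} {f : (Fin n → ℕ) → ℕ} {g : (Fin (n + 2) → ℕ) → ℕ}

theorem exists_isPrecCode (f : (Fin n → ℕ) → ℕ) (g : (Fin (n + 2) → ℕ) → ℕ)
    (x : Fin (n + 1) → ℕ) : ∃ c, IsPrecCode f g x c := by
  obtain ⟨c, hc⟩ := exists_beta_eq (fun i => Nat.rec (f (Fin.tail x))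
    (fun y ih => g (Fin.cons y (Fin.cons ih (Fin.tail x) : Fin (n + 1) → ℕ))) i) (x 0)
  refine ⟨c, hc 0 (Nat.zero_le _), fun i hi => ?_⟩
  rw [hc i hi.le, hc (i + 1) hi]

theorem IsPrecCode.beta_eq {x : Fin (n + 1) → ℕ} {c : ℕ} (h : IsPrecCode f g x c) :
    Nat.beta c (x 0) = precFun f g x := by
  suffices ∀ i ≤ x 0, Nat.beta c i = Nat.rec (f (Fin.tail x))
      (fun y ih => g (Fin.cons y (Fin.cons ih (Fin.tail x) : Fin (n + 1) → ℕ))) i from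
    this _ le_rfl
  intro i hi
  induction i with
  | zero => exact h.1
  | succ i ih => rw [h.2 i hi, ih (Nat.le_of_succ_le hi)]

theorem isRepRel_isPrecCode (hf : IsRepFun f) (hg : IsRepFun g) :
    IsRepRel fun z : Fin (n + 2) → ℕ => IsPrecCode f g (Fin.init z) (z (Fin.last (n + 1))) := by
  refine .and (.eq (.beta (isRepFun_proj _) (isRepFun_const 0))
    (hf.comp fun i => isRepFun_proj i.succ.castSucc)) ?_
  refine IsRepRel.ball (f := fun z : Fin (n + 2) → ℕ => z 0)
    (P := fun z i => Nat.beta (z (Fin.last (n + 1))) (i + 1) = g (Fin.cons i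
      (Fin.cons (Nat.beta (z (Fin.last (n + 1))) i) (Fin.tail (Fin.init z)) : Fin (n + 1) → ℕ)))
    (.eq (.beta (isRepFun_proj _) ((isRepFun_proj _).add (isRepFun_const 1))) ?_) (isRepFun_proj 0)
  -- The coordinates of `z` are the recursion argument, the `n` parameters, the code and the step
  -- index, in this order.
  have H := hg.comp (m := n + 3) (g := Fin.cons (fun z => z (Fin.last (n + 2)))
    (Fin.cons (fun z => Nat.beta (z (Fin.last (n + 1)).castSucc) (z (Fin.last (n + 2))))
      fun i z => z i.succ.castSucc.castSucc)) (by
    refine Fin.cases ?_ (Fin.cases ?_ fun i => ?_)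
    · exact isRepFun_proj _
    · exact .beta (isRepFun_proj _) (isRepFun_proj _)
    · exact isRepFun_proj _)
  refine cast (congrArg _ (funext fun z => congrArg g (funext ?_))) H
  exact Fin.cases rfl (Fin.cases rfl fun i => rfl)

/-- A code always exists, so its least value is a total function obtained by minimization; decoding
it at the recursion argument gives the result. -/
theorem isRepFun_precFun (hf : IsRepFun f) (hg : IsRepFun g) : IsRepFun (precFun f g) := by
  classical
  have hc : IsRepFun fun x => Nat.find (exists_isPrecCode f g x) :=
    (isRepRel_isPrecCode hf hg).isRepFun_of_least (fun x => Nat.find_spec (exists_isPrecCode f g x))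
      fun x _ hz => Nat.find_min (exists_isPrecCode f g x) hz
  have H := IsRepFun.beta hc (isRepFun_proj 0)
  refine cast (congrArg _ (funext fun x => ?_)) H
  exact IsPrecCode.beta_eq (Nat.find_spec (exists_isPrecCode f g x))

end

/-! ### Partial recursive functions and the conclusion -/

theorem isRepFun_of_primrec {k : ℕ} {f : List.Vector ℕ k → ℕ} (hf : Nat.Primrec' f) :
    IsRepFun fun x => f (List.Vector.ofFn x) := by
  induction hf with
  | zero => exact isRepFun_const 0
  | succ => exact (isRepFun_proj 0).add (isRepFun_const 1)
  | get i => simpa using isRepFun_proj i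
  | comp g _ _ ihf ihg => exact ihf.comp ihg
  | @prec n f g _ _ ihf ihg =>
    refine cast (congrArg _ (funext fun x => ?_)) (isRepFun_precFun ihf ihg)
    simp only [precFun, List.Vector.head_ofFn, List.Vector.tail_ofFn]
    rfl

theorem get_mem_of_mem_mOfFn {n : ℕ} {p : Fin n → Part ℕ} {w : List.Vector ℕ n}
    (hw : w ∈ List.Vector.mOfFn p) (i : Fin n) : w.get i ∈ p i := by
  induction n with
  | zero => exact i.elim0
  | succ n ih =>
    simp only [List.Vector.mOfFn, Part.bind_eq_bind, Part.mem_bind_iff, Part.pure_eq_some,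
      Part.mem_some_iff] at hw
    obtain ⟨a, ha, u, hu, rfl⟩ := hw
    refine Fin.cases ?_ (fun i => ?_) i
    · simpa using ha
    · simpa using ih hu i

theorem isRep_of_partrec {k : ℕ} {f : List.Vector ℕ k →. ℕ} (hf : Nat.Partrec' f) :
    IsRep fun x => f (List.Vector.ofFn x) := by
  induction hf with
  | prim hf => exact isRepFun_of_primrec hf
  | @comp m n f g _ _ ihf ihg =>
    refine ihf.comp ihg fun x y hy => ?_
    obtain ⟨w, hw, hy⟩ := Part.mem_bind_iff.1 hy
    refine ⟨w.get, fun i => ?_, by simpa using hy⟩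
    exact get_mem_of_mem_mOfFn hw i
  | @rfind n f _ ih =>
    -- The searched function is total here, so its vanishing is a decided relation and minimization
    -- applies.
    have ih' : IsRepFun fun x => f (List.Vector.ofFn x) := ih
    refine IsRepRel.isRep_of_least (R := fun x y => f (y ::ᵥ List.Vector.ofFn x) = 0)
      (.eq ?_ (isRepFun_const 0)) fun x y hy => ?_
    · have H := ih'.comp (m := n + 1) (g := Fin.cons (fun z => z (Fin.last n))
        fun i z => z i.castSucc) (Fin.cases (isRepFun_proj _) fun i => isRepFun_proj _)
      exact H
    · have h₁ := Nat.rfind_spec hy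
      refine ⟨by simpa using h₁, fun z hz => ?_⟩
      simpa using Nat.rfind_min hy hz

theorem representable_of_isRep {k : ℕ} {f : List.Vector ℕ k →. ℕ}
    (hf : IsRep fun x => f (List.Vector.ofFn x)) : Representable Q f := by
  obtain ⟨φ, hφ⟩ := hf
  refine ⟨φ, fun x y hy => proves_of_forall_model fun M _ hM => ?_⟩
  have key := hφ M (isQModel_of_models hM) x.get y (by simpa using hy)
  change Fml.Sat _ (default : Fin 0 → M)
  simp only [Fml.sat_inf, Fml.existsUnique, Fml.app, Fml.sat_ex, Fml.sat_all, Fml.sat_imp,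
    Fml.sat_sub, val_snoc, Tm.val_num, Tm.val_v, Fml.sat_eq, key, Fin.snoc_last, Fin.snoc_castSucc]
  simp

end Arith

theorem mainTheorem1 (k : ℕ) (f : List.Vector ℕ k →. ℕ) (hf : Partrec f) :
    Arith.Representable Arith.Q f :=
  Arith.representable_of_isRep (Arith.isRep_of_partrec (Nat.Partrec'.part_iff.2 hf))
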